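/- **Theorem.** For integers $p\ge q\ge 1$, a family $\mathcal F$ of sets (repetitions allowed, finite or infinite) has the *$(p,q)$-property* if $|\mathcal F|\ge p$, no member of $\mathcal F$ is empty, and among any $p$ members of $\mathcal F$ there are some $q$ with a non-empty intersection. $\mathcal F$ *can be pierced by $s$ points* if there is a set of at most $s$ points that meets every member of $\mathcal F$. An *axis-parallel box* in $\mathbb R^d$ is a product $[a_1,b_1]\times\dots\times[a_d,b_d]$ with $a_i\le b_i$ real, and $\mathrm{HD}_{d\text{-box}}(p,q)$ is the least $s$ such that every family of axis-parallel boxes in $\mathbb R^d$ with the $(p,q)$-property can be pierced by $s$ points. There is a universal constant $c>0$ (independent of $d$, $p$ and $q$) such that for all integers $d\ge 1$ and $p\ge q\ge 2$ with $q> c\,(\log_2 p)^{d-1}$, $$\mathrm{HD}_{d\text{-box}}(p,q)=p-q+1 .$$ -/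

import Mathlib

/-- The `(p,q)`-property of a family of sets `F`, indexed by `ι` (so that a set may occur
several times): the family has at least `p` members, all members are nonempty, and among any
`p` members there are some `q` with a common point. -/
def HasPQProperty {X ι : Type} (F : ι → Set X) (p q : ℕ) : Prop :=
  (p : ℕ∞) ≤ ENat.card ι ∧ (∀ i, (F i).Nonempty) ∧
    ∀ A : Finset ι, A.card = p → ∃ B ⊆ A, B.card = q ∧ (⋂ i ∈ B, F i).Nonempty

/-- The family `F` can be pierced by `s` points: it has a transversal of at most `s` points. -/
def CanBePierced {X ι : Type} (F : ι → Set X) (s : ℕ) : Prop :=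
  ∃ P : Finset X, P.card ≤ s ∧ ∀ i, ∃ x ∈ P, x ∈ F i

/-- `s` is the Hadwiger–Debrunner number `HD(p,q)` of the class `C` of sets: the least `s` such
that every (finite or infinite) family of members of `C` that has the `(p,q)`-property can be
pierced by `s` points. -/
def IsHDNumber {X : Type} (C : Set (Set X)) (p q s : ℕ) : Prop :=
  IsLeast {t : ℕ | ∀ (ι : Type) (F : ι → Set X), (∀ i, F i ∈ C) → HasPQProperty F p q →
    CanBePierced F t} s

/-- The axis-parallel boxes in `ℝ^d`: the products `[a₁, b₁] × ⋯ × [a_d, b_d]` of nonempty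
compact intervals (the order on `Fin d → ℝ` is the coordinatewise one). -/
def axisParallelBoxes (d : ℕ) : Set (Set (Fin d → ℝ)) :=
  {S | ∃ a b : Fin d → ℝ, a ≤ b ∧ S = Set.Icc a b}

/-! Let `S` be a maximum pairwise disjoint subfamily (a layer) and `T` a maximum one among the other
sets. Sets with a common point include at most one member of a layer, so deleting both layers lowers
`p` by |S| + |T| and `q` by only 2. By Hall's theorem, |S| points pierce both. If |T| ≥ 2, then `p -
q` drops by at least |S|, which pays for these points. If |T| ≤ 1, the remaining sets pairwise
intersect, and the Helly property of boxes gives |S| ≤ p - q + 1 points for everything.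

Peeling alone suffices when `p` is below about `2 q`. In general it must end in a family of small
matching number `w`, which `piercedBy_partialBox` pierces with O(w (log w)^(d-1)) points. If `p -
|S| < 3 q`, peeling continues until `w ≤ 8` or the range `p ≤ 2 q - 2` is reached
(`PQOn.piercedBy_of_large`). Otherwise about `q` layers are peeled (`PQOn.exists_layers`), which
forces `q w` to be at most about `p - |S|`. The hypothesis on `q` then makes the transversal of the
remainder cheaper than the saving from pairing layers.

Compactness passes from finite to infinite families, and repeated singletons give the lower bound.
-/

open Finset

/-! ### Disjoint layers and transversals in abstract families -/

/-- The finite subfamily `A` of `F` has a transversal of at most `n` points. -/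
def PiercedBy {X ι : Type} (F : ι → Set X) (A : Finset ι) (n : ℕ) : Prop :=
  ∃ P : Finset X, P.card ≤ n ∧ ∀ i ∈ A, ∃ x ∈ P, x ∈ F i

/-- The finite subfamily `A` of `F` has the `(p,q)`-property. -/
def PQOn {X ι : Type} (F : ι → Set X) (A : Finset ι) (p q : ℕ) : Prop :=
  p ≤ A.card ∧ ∀ B ⊆ A, B.card = p → ∃ C ⊆ B, C.card = q ∧ (⋂ i ∈ C, F i).Nonempty

/-- Any pairwise disjoint subfamily of `A` has at most `n` members. -/
def MatchingLE {X ι : Type} (F : ι → Set X) (A : Finset ι) (n : ℕ) : Prop :=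
  ∀ S ⊆ A, (S : Set ι).PairwiseDisjoint F → S.card ≤ n

/-- `S` is a pairwise disjoint subfamily of `A` of maximum size. -/
def IsMaxMatching {X ι : Type} (F : ι → Set X) (A S : Finset ι) : Prop :=
  S ⊆ A ∧ (S : Set ι).PairwiseDisjoint F ∧ MatchingLE F A S.card

/-- Pairwise intersecting finite subfamilies of `F` have a common point. -/
def HellyTwo {X ι : Type} (F : ι → Set X) : Prop :=
  ∀ A : Finset ι, (∀ i ∈ A, ∀ j ∈ A, ¬ Disjoint (F i) (F j)) → PiercedBy F A 1

section Graph

variable {X ι : Type} {F : ι → Set X} {A B S T : Finset ι} {m n p q : ℕ}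

theorem PiercedBy.mono (h : PiercedBy F A m) (hmn : m ≤ n) : PiercedBy F A n :=
  let ⟨P, hP, hA⟩ := h
  ⟨P, hP.trans hmn, hA⟩

theorem PiercedBy.subset (h : PiercedBy F A n) (hBA : B ⊆ A) : PiercedBy F B n :=
  let ⟨P, hP, hA⟩ := h
  ⟨P, hP, fun i hi => hA i (hBA hi)⟩

theorem PiercedBy.union [DecidableEq ι] (hA : PiercedBy F A m) (hB : PiercedBy F B n) :
    PiercedBy F (A ∪ B) (m + n) := by
  classical
  obtain ⟨P, hP, hA⟩ := hA
  obtain ⟨Q, hQ, hB⟩ := hB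
  refine ⟨P ∪ Q, (card_union_le _ _).trans (by lia), fun i hi => ?_⟩
  rcases mem_union.1 hi with h | h
  · obtain ⟨x, hx, hxi⟩ := hA i h
    exact ⟨x, mem_union_left _ hx, hxi⟩
  · obtain ⟨x, hx, hxi⟩ := hB i h
    exact ⟨x, mem_union_right _ hx, hxi⟩

theorem MatchingLE.subset (h : MatchingLE F A n) (hBA : B ⊆ A) : MatchingLE F B n :=
  fun S hS => h S (hS.trans hBA)

theorem MatchingLE.mono (h : MatchingLE F A m) (hmn : m ≤ n) : MatchingLE F A n :=
  fun S hS hd => (h S hS hd).trans hmn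

theorem exists_isMaxMatching (F : ι → Set X) (A : Finset ι) : ∃ S, IsMaxMatching F A S := by
  classical
  obtain ⟨S, hS, hmax⟩ :=
    (A.powerset.filter fun S : Finset ι => (S : Set ι).PairwiseDisjoint F).exists_max_image
      Finset.card ⟨∅, by simp⟩
  simp only [mem_filter, mem_powerset] at hS hmax
  exact ⟨S, hS.1, hS.2, fun S' h h' => hmax S' ⟨h, h'⟩⟩

theorem piercedBy_of_matchingLE_zero (h : MatchingLE F A 0) :
    PiercedBy F A 0 := by
  refine ⟨∅, by simp, fun i hi => ?_⟩
  have := h {i} (by simpa using hi) (by simp)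
  simp at this

theorem not_disjoint_of_matchingLE_one (hF : ∀ i, (F i).Nonempty) (h : MatchingLE F A 1)
    {i j : ι} (hi : i ∈ A) (hj : j ∈ A) : ¬ Disjoint (F i) (F j) := by
  classical
  intro hd
  have hij : i ≠ j := by
    rintro rfl
    exact (hF i).ne_empty (disjoint_self.1 hd)
  have := h {i, j} (by simp [insert_subset_iff, hi, hj]) (by
    rw [coe_insert, coe_singleton, Set.pairwiseDisjoint_insert]
    exact ⟨Set.pairwiseDisjoint_singleton _ _, fun k hk _ => Set.mem_singleton_iff.1 hk ▸ hd⟩)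
  rw [card_pair hij] at this
  lia

theorem piercedBy_of_choice (g : ι → X) (h : ∀ i ∈ A, ∃ s ∈ S, g s ∈ F i) :
    PiercedBy F A S.card := by
  classical
  refine ⟨S.image g, card_image_le, fun i hi => ?_⟩
  obtain ⟨s, hs, hsi⟩ := h i hi
  exact ⟨g s, mem_image_of_mem _ hs, hsi⟩

/-- Hall's theorem matches a second layer of disjoint sets into a maximum one. -/
theorem IsMaxMatching.piercedBy_union [DecidableEq ι] (hF : ∀ i, (F i).Nonempty)
    (hS : IsMaxMatching F A S) (hT : T ⊆ A \ S) (hTd : (T : Set ι).PairwiseDisjoint F) :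
    PiercedBy F (S ∪ T) S.card := by
  classical
  obtain ⟨hSA, hSd, hmax⟩ := hS
  have hall : ∃ f : T → ι, Function.Injective f ∧
      ∀ x : T, f x ∈ S.filter fun s => ¬ Disjoint (F x) (F s) := by
    rw [← all_card_le_biUnion_card_iff_exists_injective]
    intro U
    set N := U.biUnion fun x => S.filter fun s => ¬ Disjoint (F x) (F s) with hN
    have hNS : N ⊆ S := by
      intro s hs
      simp only [hN, mem_biUnion, mem_filter] at hs
      obtain ⟨_, _, h, _⟩ := hs
      exact h
    set V : Finset ι := U.map (Function.Embedding.subtype _) with hV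
    have hVT : V ⊆ T := by
      intro x hx
      simp only [hV, mem_map, Function.Embedding.subtype_apply] at hx
      obtain ⟨y, _, rfl⟩ := hx
      exact y.2
    have hcross : ∀ v ∈ V, ∀ s ∈ S \ N, Disjoint (F v) (F s) := by
      intro v hv s hs
      simp only [hV, mem_map, Function.Embedding.subtype_apply] at hv
      obtain ⟨y, hy, rfl⟩ := hv
      by_contra hd
      refine (mem_sdiff.1 hs).2 ?_
      simp only [hN, mem_biUnion, mem_filter]
      exact ⟨y, hy, (mem_sdiff.1 hs).1, hd⟩
    have hdis : Disjoint (S \ N) V := by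
      rw [Finset.disjoint_left]
      intro x hx hxV
      exact (mem_sdiff.1 (hT (hVT hxV))).2 (mem_sdiff.1 hx).1
    -- Exchanging `N` for `V` keeps the family disjoint, so maximality of `S` gives |V| ≤ |N|, which
    -- is Hall's condition.
    have hcard := hmax ((S \ N) ∪ V) (union_subset (sdiff_subset.trans hSA)
      (hVT.trans (hT.trans sdiff_subset))) (by
        intro x hx y hy hxy
        rw [mem_coe, mem_union] at hx hy
        rcases hx with hx | hx <;> rcases hy with hy | hy
        · exact hSd (mem_sdiff.1 hx).1 (mem_sdiff.1 hy).1 hxy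
        · exact (hcross y hy x hx).symm
        · exact hcross x hx y hy
        · exact hTd (hVT hx) (hVT hy) hxy)
    rw [card_union_of_disjoint hdis, card_sdiff_of_subset hNS, hV, card_map] at hcard
    have := card_le_card hNS
    lia
  obtain ⟨f, hf, hfS⟩ := hall
  -- One point per member of `S`, taken in the intersection with its Hall partner if it has one.
  have hg : ∀ s : ι, ∃ x ∈ F s, ∀ t : T, f t = s → x ∈ F t := by
    intro s
    by_cases h : ∃ t : T, f t = s
    · obtain ⟨t, rfl⟩ := h
      obtain ⟨x, hx, hx'⟩ := Set.not_disjoint_iff.1 (mem_filter.1 (hfS t)).2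
      exact ⟨x, hx', fun t' ht' => hf ht' ▸ hx⟩
    · obtain ⟨x, hx⟩ := hF s
      exact ⟨x, hx, fun t ht => (h ⟨t, ht⟩).elim⟩
  choose g hg hg' using hg
  refine piercedBy_of_choice g fun i hi => ?_
  rcases mem_union.1 hi with h | h
  · exact ⟨i, h, hg i⟩
  · exact ⟨f ⟨i, h⟩, (mem_filter.1 (hfS ⟨i, h⟩)).1, hg' _ ⟨i, h⟩ rfl⟩

theorem IsMaxMatching.piercedBy_add [DecidableEq ι] (hF : ∀ i, (F i).Nonempty)
    (hS : IsMaxMatching F A S) (hT : IsMaxMatching F (A \ S) T)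
    (h : PiercedBy F ((A \ S) \ T) n) : PiercedBy F A (S.card + n) := by
  refine ((hS.piercedBy_union hF hT.1 hT.2.1).union h).subset fun i hi => ?_
  simp only [mem_union, mem_sdiff]
  tauto

/-- Each `s ∈ S`, with the sets outside `S` that meet it, forms a pairwise intersecting family and
so has a common point. By maximality every set outside `S` meets some `s`. -/
theorem IsMaxMatching.piercedBy_of_clique [DecidableEq ι] (hF : ∀ i, (F i).Nonempty)
    (hH : HellyTwo F) (hS : IsMaxMatching F A S) (hT : MatchingLE F (A \ S) 1) :
    PiercedBy F A S.card := by
  classical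
  obtain ⟨hSA, hSd, hmax⟩ := hS
  have hg : ∀ s : ι, ∃ x, ∀ i ∈ insert s ((A \ S).filter fun t => ¬ Disjoint (F s) (F t)),
      x ∈ F i := by
    intro s
    obtain ⟨P, hP, h⟩ := hH (insert s ((A \ S).filter fun t => ¬ Disjoint (F s) (F t))) (by
      intro i hi j hj
      rw [mem_insert, mem_filter] at hi hj
      rcases hi with rfl | hi <;> rcases hj with rfl | hj
      · rw [disjoint_self]
        exact (hF _).ne_empty
      · exact hj.2
      · exact fun hd => hi.2 hd.symm
      · exact not_disjoint_of_matchingLE_one hF hT hi.1 hj.1)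
    obtain ⟨x, hx, -⟩ := h s (mem_insert_self _ _)
    refine ⟨x, fun i hi => ?_⟩
    obtain ⟨y, hy, hyi⟩ := h i hi
    rwa [card_le_one.1 hP x hx y hy]
  choose g hg using hg
  refine piercedBy_of_choice g fun i hi => ?_
  by_cases his : i ∈ S
  · exact ⟨i, his, hg i i (mem_insert_self _ _)⟩
  · by_contra hcon
    push Not at hcon
    have hdis : ∀ s ∈ S, Disjoint (F s) (F i) := by
      intro s hs
      by_contra hd
      exact hcon s hs (hg s i (by simp [hi, his, hd]))
    have := hmax (insert i S) (insert_subset hi hSA) (by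
      rw [coe_insert, Set.pairwiseDisjoint_insert]
      exact ⟨hSd, fun s hs _ => (hdis s hs).symm⟩)
    rw [card_insert_of_notMem his] at this
    lia

theorem PQOn.le (h : PQOn F A p q) : q ≤ p := by
  obtain ⟨B, hB, hBp⟩ := exists_subset_card_eq h.1
  obtain ⟨C, hC, hCq, -⟩ := h.2 B hB hBp
  rw [← hCq, ← hBp]
  exact card_le_card hC

theorem card_inter_le_one_of_common_point [DecidableEq ι] (hS : (S : Set ι).PairwiseDisjoint F)
    (hB : (⋂ i ∈ B, F i).Nonempty) : (B ∩ S).card ≤ 1 := by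
  obtain ⟨x, hx⟩ := hB
  rw [Set.mem_iInter₂] at hx
  refine card_le_one.2 fun i hi j hj => ?_
  rw [mem_inter] at hi hj
  by_contra hij
  exact Set.disjoint_left.1 (hS hi.2 hj.2 hij) (hx i hi.1) (hx j hj.1)

/-- Adjoin `S` to any `p - |S|` of the other sets: among the `q` sets with a common point at most
one lies in `S`. -/
theorem PQOn.sdiff [DecidableEq ι] (h : PQOn F A p q) (hq : 2 ≤ q) (hSA : S ⊆ A)
    (hS : (S : Set ι).PairwiseDisjoint F) :
    S.card ≤ p ∧ PQOn F (A \ S) (p - S.card) (q - 1) := by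
  have hSp : S.card ≤ p := by
    by_contra! hlt
    obtain ⟨B, hB, hBp⟩ := exists_subset_card_eq hlt.le
    obtain ⟨C, hC, hCq, hne⟩ := h.2 B (hB.trans hSA) hBp
    have := card_inter_le_one_of_common_point hS hne
    rw [inter_eq_left.2 (hC.trans hB)] at this
    lia
  refine ⟨hSp, ?_, fun B hB hBp => ?_⟩
  · rw [card_sdiff_of_subset hSA]
    have := h.1
    lia
  · have hdis : Disjoint B S := disjoint_of_subset_left hB sdiff_disjoint
    obtain ⟨C, hC, hCq, x, hx⟩ := h.2 (B ∪ S) (union_subset (hB.trans sdiff_subset) hSA) (by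
      rw [card_union_of_disjoint hdis]
      lia)
    have h1 := card_inter_le_one_of_common_point hS ⟨x, hx⟩
    have h2 := card_sdiff_add_card_inter C S
    obtain ⟨D, hD, hDq⟩ := exists_subset_card_eq (show q - 1 ≤ (C \ S).card by lia)
    refine ⟨D, fun i hi => ?_, hDq, x, ?_⟩
    · have := mem_sdiff.1 (hD hi)
      exact (mem_union.1 (hC this.1)).resolve_right this.2
    · rw [Set.mem_iInter₂] at hx ⊢
      exact fun i hi => hx i (mem_sdiff.1 (hD hi)).1

/-- The tight bound for `p ≤ 2 q - 2`, and for `q ≥ p / 4 + O(1)`. -/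
theorem PQOn.piercedBy_of_large [DecidableEq ι] (hF : ∀ i, (F i).Nonempty) (hH : HellyTwo F)
    {G : ℕ} (hG2 : 2 ≤ G) (hG : ∀ A, MatchingLE F A 8 → PiercedBy F A G) :
    ∀ (p q : ℕ) (A : Finset ι), PQOn F A p q → (p + 2 ≤ 2 * q ∨ 4 * G + p ≤ 4 * q) →
      PiercedBy F A (p - q + 1) := by
  intro p
  induction p using Nat.strong_induction_on with
  | _ p ih =>
    intro q A hA hpq
    have hle := hA.le
    have hq : 2 ≤ q := by lia
    obtain ⟨S, hS⟩ := exists_isMaxMatching F A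
    obtain ⟨T, hT⟩ := exists_isMaxMatching F (A \ S)
    obtain ⟨hSp, hA1⟩ := hA.sdiff hq hS.1 hS.2.1
    have hle1 := hA1.le
    -- In the clique case |S| points suffice, and `q - 1 ≤ p - |S|` bounds |S| by `p - q + 1`.
    rcases le_or_gt T.card 1 with hT1 | hT1
    · exact (hS.piercedBy_of_clique hF hH (hT.2.2.mono hT1)).mono (by lia)
    have hTS : T.card ≤ S.card := hS.2.2 T (hT.1.trans sdiff_subset) hT.2.1
    -- Two layers remove at least 4 from `p` and 2 from `q`, so `p + 2 ≤ 2 * q` is inherited.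
    rcases le_or_gt (p + 2) (2 * q) with h | h
    · obtain ⟨hTp, hA2⟩ := hA1.sdiff (by lia) hT.1 hT.2.1
      have hle2 := hA2.le
      exact (hS.piercedBy_add hF hT (ih _ (by lia) _ _ hA2 (by lia))).mono (by lia)
    -- If |S| ≤ 8, then `G ≤ p - q + 1` follows from `4 * G + p ≤ 4 * q` and `2 * q < p + 2`.
    -- Otherwise `p` loses at least 8 while `4 * q` loses exactly 8, so the second condition is
    -- inherited.
    · rcases le_or_gt S.card 8 with h8 | h8
      · exact (hG A (hS.2.2.mono h8)).mono (by lia)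
      · obtain ⟨hTp, hA2⟩ := hA1.sdiff (by lia) hT.1 hT.2.1
        have hle2 := hA2.le
        exact (hS.piercedBy_add hF hT (ih _ (by lia) _ _ hA2 (by lia))).mono (by lia)

/-- Removing `2 m` layers of disjoint sets, paired up so that each pair is pierced at the cost of
its larger layer. -/
theorem PQOn.exists_layers [DecidableEq ι] (hF : ∀ i, (F i).Nonempty) :
    ∀ (m p q : ℕ) (A S : Finset ι), PQOn F A p q → 2 * m + 2 ≤ q → IsMaxMatching F A S →
      ∃ (B : Finset ι) (s w : ℕ), MatchingLE F B w ∧ w ≤ S.card ∧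
        (∀ n, PiercedBy F B n → PiercedBy F A (s + n)) ∧
        2 * s + 2 * w ≤ p + S.card ∧ 2 * m * w + S.card ≤ p := by
  intro m
  induction m with
  | zero =>
    intro p q A S hA hq hS
    have := (hA.sdiff (by lia) hS.1 hS.2.1).1
    exact ⟨A, 0, S.card, hS.2.2, le_rfl, fun n h => by rwa [zero_add], by lia, by lia⟩
  | succ m ih =>
    intro p q A S hA hq hS
    obtain ⟨hSp, hA1⟩ := hA.sdiff (by lia) hS.1 hS.2.1
    obtain ⟨T, hT⟩ := exists_isMaxMatching F (A \ S)
    obtain ⟨hTp, hA2⟩ := hA1.sdiff (by lia) hT.1 hT.2.1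
    obtain ⟨U, hU⟩ := exists_isMaxMatching F ((A \ S) \ T)
    obtain ⟨B, s, w, hB, hw, hs, h1, h2⟩ := ih _ _ _ U hA2 (by lia) hU
    -- Layer sizes do not increase. Hence, except for the first, each paid layer costs at most the
    -- average of itself and its predecessor, and `w` is at most the size of every layer. All layers
    -- together have at most `p` members.
    have hTS : T.card ≤ S.card := hS.2.2 T (hT.1.trans sdiff_subset) hT.2.1
    have hUT : U.card ≤ T.card := hT.2.2 U (hU.1.trans sdiff_subset) hU.2.1
    refine ⟨B, S.card + s, w, hB, by lia, fun n hn => ?_, by lia, ?_⟩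
    · rw [add_assoc]
      exact hS.piercedBy_add hF hT (hs n hn)
    · have : 2 * (m + 1) * w = 2 * m * w + 2 * w := by ring
      lia

end Graph

/-! ### Transversals of boxes in terms of the matching number -/

/-- The box with side `[a j, b j]` in the coordinates `j ∈ D`, unbounded in the others. -/
def partialBox {κ : Type} (D : Finset κ) (a b : κ → ℝ) : Set (κ → ℝ) :=
  {x | ∀ j ∈ D, a j ≤ x j ∧ x j ≤ b j}

/-- The bound for the transversal number of a family of boxes in `ℝ^d` that has at most `2 ^ k`
pairwise disjoint members. -/
def boxBound : ℕ → ℕ → ℕ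
  | 0, _ => 1
  | _ + 1, 0 => 1
  | d + 1, k + 1 => 2 * boxBound (d + 1) k + boxBound d (k + 1)

/-- With `w = 2 ^ k` this is the O(w (log w)^d) bound in dimension `d + 1`. The `- 1` lets the
one-dimensional recursion `x ↦ 2 x + 1` close. -/
theorem boxBound_succ_le : ∀ d k, boxBound (d + 1) k ≤ 2 ^ (k + 1) * (k + 1) ^ d - 1
  | _, 0 => by simp [boxBound]
  | 0, k + 1 => by
    have := boxBound_succ_le 0 k
    rw [boxBound, boxBound]
    rw [pow_zero, mul_one] at this ⊢
    have h2 : 2 ^ (k + 1 + 1) = 2 * 2 ^ (k + 1) := by ring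
    have := Nat.one_le_two_pow (n := k + 1)
    lia
  | d + 1, k + 1 => by
    have h1 := boxBound_succ_le (d + 1) k
    have h2 := boxBound_succ_le d (k + 1)
    have h3 : (k + 1) ^ (d + 1) ≤ (k + 1) * (k + 2) ^ d := by
      rw [pow_succ']
      gcongr
      lia
    have h4 : 0 < 2 ^ (k + 1) * (k + 1) ^ (d + 1) := by positivity
    have h5 : 2 ^ (k + 1) * (k + 1) ^ (d + 1) ≤ 2 ^ (k + 1) * ((k + 1) * (k + 2) ^ d) := by gcongr
    have h6 : 2 ^ (k + 1 + 1) * (k + 1 + 1) ^ (d + 1) =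
        2 * (2 ^ (k + 1) * ((k + 1) * (k + 2) ^ d)) + 2 ^ (k + 1 + 1) * (k + 1 + 1) ^ d := by ring
    have h7 : 0 < 2 ^ (k + 1 + 1) * (k + 1 + 1) ^ d := by positivity
    rw [boxBound]
    lia

section Box

variable {κ ι : Type} {a b : ι → κ → ℝ} {D : Finset κ}

theorem partialBox_nonempty (hab : ∀ i, a i ≤ b i) (i : ι) :
    (partialBox D (a i) (b i)).Nonempty :=
  ⟨a i, fun j _ => ⟨le_rfl, hab i j⟩⟩

theorem not_disjoint_partialBox_iff (hab : ∀ i, a i ≤ b i) {i k : ι} :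
    ¬ Disjoint (partialBox D (a i) (b i)) (partialBox D (a k) (b k)) ↔
      ∀ j ∈ D, a i j ≤ b k j ∧ a k j ≤ b i j := by
  rw [Set.not_disjoint_iff]
  constructor
  · rintro ⟨x, hi, hk⟩ j hj
    exact ⟨(hi j hj).1.trans (hk j hj).2, (hk j hj).1.trans (hi j hj).2⟩
  · intro h
    refine ⟨fun j => max (a i j) (a k j), fun j hj => ⟨le_max_left _ _, ?_⟩,
      fun j hj => ⟨le_max_right _ _, ?_⟩⟩
    · exact max_le (hab i j) (h j hj).2
    · exact max_le (h j hj).1 (hab k j)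

/-- The point whose coordinates are the largest left endpoints lies in every box. -/
theorem hellyTwo_partialBox (hab : ∀ i, a i ≤ b i) (D : Finset κ) :
    HellyTwo fun i => partialBox D (a i) (b i) := by
  intro A hA
  rcases A.eq_empty_or_nonempty with rfl | hne
  · exact ⟨∅, by simp, by simp⟩
  · refine ⟨{fun j => A.sup' hne fun i => a i j}, by simp, fun i hi =>
      ⟨_, mem_singleton_self _, fun j hj => ⟨le_sup' (fun i => a i j) hi, ?_⟩⟩⟩
    refine sup'_le _ _ fun k hk => ?_
    exact ((not_disjoint_partialBox_iff hab).1 (hA k hk i hi) j hj).1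

/-- Families of boxes with few pairwise disjoint members have small transversals: divide by a
hyperplane that halves the matching number on both sides. -/
theorem piercedBy_partialBox [DecidableEq κ] (hab : ∀ i, a i ≤ b i) (D : Finset κ) :
    ∀ (k : ℕ) (A : Finset ι), MatchingLE (fun i => partialBox D (a i) (b i)) A (2 ^ k) →
      PiercedBy (fun i => partialBox D (a i) (b i)) A (boxBound D.card k) := by
  classical
  induction D using Finset.induction_on with
  | empty =>
    intro k A _
    rw [card_empty, boxBound]
    exact ⟨{0}, by simp, fun i _ => ⟨0, by simp, fun j hj => by simp at hj⟩⟩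
  | insert c D hc ihD =>
    set F : ι → Set (κ → ℝ) := fun i => partialBox (insert c D) (a i) (b i) with hFdef
    rw [card_insert_of_notMem hc]
    intro k
    induction k with
    | zero =>
      intro A hA
      rw [boxBound]
      exact hellyTwo_partialBox hab _ A fun i hi j hj =>
        not_disjoint_of_matchingLE_one (partialBox_nonempty hab) hA hi hj
    | succ k ihk =>
      intro A hA
      rw [boxBound]
      by_cases hsmall : MatchingLE F A (2 ^ k)
      · exact (ihk A hsmall).mono (by lia)
      -- The cut is at the least right endpoint `t` for which the boxes ending at or before `t`
      -- contain more than `2 ^ k` disjoint ones. Minimality controls the boxes strictly to the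
      -- left.
      set J := A.filter fun j => ¬ MatchingLE F (A.filter fun i => b i c ≤ b j c) (2 ^ k) with hJ
      have hJne : J.Nonempty := by
        have hAne : A.Nonempty := by
          rw [nonempty_iff_ne_empty]
          rintro rfl
          exact hsmall fun S hS _ => by simp [subset_empty.1 hS]
        obtain ⟨j, hj, hmax⟩ := A.exists_max_image (fun i => b i c) hAne
        refine ⟨j, mem_filter.2 ⟨hj, ?_⟩⟩
        rwa [filter_true_of_mem hmax]
      obtain ⟨j, hj, hmin⟩ := J.exists_min_image (fun i => b i c) hJne
      obtain ⟨hjA, hjbig⟩ := mem_filter.1 hj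
      set t := b j c with ht
      have hleft : MatchingLE F (A.filter fun i => b i c < t) (2 ^ k) := by
        rcases (A.filter fun i => b i c < t).eq_empty_or_nonempty with h0 | h0
        · rw [h0]
          exact fun S hS _ => by simp [subset_empty.1 hS]
        · obtain ⟨l, hl, hmax⟩ := exists_max_image _ (fun i => b i c) h0
          obtain ⟨hlA, hlt⟩ := mem_filter.1 hl
          have hlJ : l ∉ J := fun h => (hmin l h).not_gt hlt
          have hlm : MatchingLE F (A.filter fun i => b i c ≤ b l c) (2 ^ k) := by
            by_contra h
            exact hlJ (mem_filter.2 ⟨hlA, h⟩)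
          refine hlm.subset fun i hi => ?_
          exact mem_filter.2 ⟨(mem_filter.1 hi).1, hmax i hi⟩
      -- A disjoint family right of the cut is disjoint from the more than `2 ^ k` boxes ending by
      -- `t`, and the total is at most `2 ^ (k + 1)`.
      have hright : MatchingLE F (A.filter fun i => t < a i c) (2 ^ k) := by
        intro S hS hSd
        unfold MatchingLE at hjbig
        push Not at hjbig
        obtain ⟨T, hT, hTd, hTk⟩ := hjbig
        have hcross : ∀ i ∈ S, ∀ l ∈ T, Disjoint (F i) (F l) := by
          intro i hi l hl
          by_contra hd
          have h1 := ((not_disjoint_partialBox_iff hab).1 hd c (mem_insert_self _ _)).1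
          exact absurd ((mem_filter.1 (hS hi)).2.trans_le h1) (mem_filter.1 (hT hl)).2.not_gt
        have hdis : Disjoint S T := by
          rw [Finset.disjoint_left]
          intro i hi hiT
          exact (partialBox_nonempty hab i).ne_empty (disjoint_self.1 (hcross i hi i hiT))
        have := hA (S ∪ T) (union_subset (hS.trans (filter_subset _ _))
          (hT.trans (filter_subset _ _))) (by
            rw [coe_union, Set.pairwiseDisjoint_union]
            exact ⟨hSd, hTd, fun i hi l hl _ => hcross i hi l hl⟩)
        rw [card_union_of_disjoint hdis, pow_succ] at this
        lia
      set M := A.filter fun i => a i c ≤ t ∧ t ≤ b i c with hM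
      -- Boxes meeting the hyperplane `x c = t` intersect in coordinate `c` automatically. Dropping
      -- that coordinate creates no new disjoint pairs, and piercing points are moved onto the
      -- hyperplane.
      have hmid : PiercedBy F M (boxBound D.card (k + 1)) := by
        obtain ⟨P, hP, h⟩ := ihD (k + 1) M (by
          intro S hS hSd
          refine hA S (hS.trans (filter_subset _ _)) fun i hi l hl hil => ?_
          by_contra hd
          refine absurd (hSd hi hl hil) ((not_disjoint_partialBox_iff hab).2 fun m hm => ?_)
          exact (not_disjoint_partialBox_iff hab).1 hd m (mem_insert_of_mem hm))
        refine ⟨P.image fun x => Function.update x c t, card_image_le.trans hP, fun i hi => ?_⟩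
        obtain ⟨x, hx, hxi⟩ := h i hi
        refine ⟨_, mem_image_of_mem _ hx, fun m hm => ?_⟩
        rcases eq_or_ne m c with rfl | hmc
        · simpa using (mem_filter.1 hi).2
        · rw [Function.update_of_ne hmc]
          exact hxi m (mem_of_mem_insert_of_ne hm hmc)
      refine (((ihk _ hleft).union (ihk _ hright)).union hmid).subset (fun i hi => ?_) |>.mono
        (by lia)
      simp only [hM, mem_union, mem_filter, hi, true_and]
      rcases lt_or_ge (b i c) t with h | h
      · exact Or.inl (Or.inl h)
      rcases lt_or_ge t (a i c) with h' | h'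
      · exact Or.inl (Or.inr h')
      · exact Or.inr ⟨h', h⟩

end Box

/-! ### Passage to infinite families -/

/-- Compactness: if every finite subfamily of a family of compact sets can be pierced by `n` points,
then so can the whole family. -/
theorem canBePierced_of_forall_piercedBy {X ι : Type} [TopologicalSpace X] [T2Space X] [Nonempty X]
    {F : ι → Set X} (hF : ∀ i, IsCompact (F i)) {n : ℕ} (h : ∀ A, PiercedBy F A n) :
    CanBePierced F n := by
  classical
  have htuple : ∀ A : Finset ι, ∃ f : Fin n → X, ∀ i ∈ A, ∃ m, f m ∈ F i := by
    intro A
    obtain ⟨P, hP, hPA⟩ := h A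
    obtain ⟨e⟩ : Nonempty (P ↪ Fin n) :=
      Function.Embedding.nonempty_of_card_le (by simpa using hP)
    refine ⟨Function.extend e Subtype.val fun _ => Classical.arbitrary X, fun i hi => ?_⟩
    obtain ⟨x, hx, hxi⟩ := hPA i hi
    exact ⟨e ⟨x, hx⟩, by rwa [e.injective.extend_apply]⟩
  choose f hf using htuple
  set U : Ultrafilter (Finset ι) := Ultrafilter.of Filter.atTop with hU
  have hUle : (U : Filter (Finset ι)) ≤ Filter.atTop := Ultrafilter.of_le _
  refine ⟨univ.image fun m => Filter.limUnder (U : Filter (Finset ι)) fun A => f A m,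
    card_image_le.trans (by simp), fun i => ?_⟩
  have hev : ∀ᶠ A in (U : Filter (Finset ι)), ∃ m, f A m ∈ F i := by
    filter_upwards [hUle (Filter.eventually_ge_atTop ({i} : Finset ι))] with A hA
    exact hf A i (hA (mem_singleton_self i))
  -- The ultrafilter selects a single index `m` among finitely many, so the limit of the `m`-th
  -- points lies in the compact set `F i`.
  obtain ⟨m, hm⟩ : ∃ m, ∀ᶠ A in (U : Filter (Finset ι)), f A m ∈ F i :=
    Ultrafilter.eventually_exists_iff.1 hev
  obtain ⟨x, hx, hxle⟩ := (hF i).ultrafilter_le_nhds (U.map fun A => f A m)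
    (Filter.le_principal_iff.2 hm)
  have ht : Filter.Tendsto (fun A => f A m) (U : Filter (Finset ι)) (nhds x) := hxle
  refine ⟨_, mem_image_of_mem _ (mem_univ m), ?_⟩
  rwa [ht.limUnder_eq]

/-- A finite subfamily may have fewer than `p` members, so `p` members of the whole family are
adjoined. -/
theorem HasPQProperty.exists_pqOn {X ι : Type} {F : ι → Set X} {p q : ℕ}
    (h : HasPQProperty F p q) (A : Finset ι) : ∃ B, A ⊆ B ∧ PQOn F B p q := by
  classical
  obtain ⟨S, -, hS⟩ := Set.exists_subset_encard_eq (s := (Set.univ : Set ι)) (k := p)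
    (by simpa [Set.encard_univ] using h.1)
  have hfin : S.Finite := Set.finite_of_encard_eq_coe hS
  refine ⟨A ∪ hfin.toFinset, subset_union_left, ?_, fun B _ hB => h.2.2 B hB⟩
  rw [hfin.encard_eq_coe_toFinset_card] at hS
  exact (Nat.cast_injective hS).ge.trans (card_le_card subset_union_right)

/-! ### The lower bound -/

/-- Singletons of which `p - q` occur once and one occurs `q` times. -/
theorem le_of_forall_canBePierced {d p q t : ℕ} (hd : 1 ≤ d) (hq : 1 ≤ q) (hqp : q ≤ p)
    (h : ∀ (ι : Type) (F : ι → Set (Fin d → ℝ)), (∀ i, F i ∈ axisParallelBoxes d) →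
      HasPQProperty F p q → CanBePierced F t) : p - q + 1 ≤ t := by
  classical
  set v : ℕ → Fin d → ℝ := fun n _ => n with hv
  have hvinj : Function.Injective v := by
    intro m n hmn
    have := congrFun hmn ⟨0, hd⟩
    exact Nat.cast_injective this
  obtain ⟨P, hP, hPF⟩ := h (Fin p) (fun i => Set.Icc (v (min i (p - q))) (v (min i (p - q))))
    (fun i => ⟨_, _, le_rfl, rfl⟩) ⟨by simp, fun i => by simp, fun A hA => by
      have hAu : A = univ := (card_eq_iff_eq_univ A).1 (by simpa using hA)
      subst hAu
      refine ⟨univ.image fun i : Fin q => (⟨p - q + i, by lia⟩ : Fin p), subset_univ _, ?_, ?_⟩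
      · rw [card_image_of_injective, card_univ, Fintype.card_fin]
        intro i j hij
        simpa [Fin.ext_iff] using hij
      · refine ⟨v (p - q), ?_⟩
        rw [Set.mem_iInter₂]
        intro i hi
        obtain ⟨j, -, rfl⟩ := mem_image.1 hi
        simp⟩
  refine le_trans ?_ hP
  have hsub : (range (p - q + 1)).image v ⊆ P := by
    intro x hx
    obtain ⟨n, hn, rfl⟩ := mem_image.1 hx
    rw [mem_range] at hn
    obtain ⟨y, hy, hyF⟩ := hPF ⟨n, by lia⟩
    have hyn : y = v n := by
      simpa [show min n (p - q) = n by lia] using hyF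
    rwa [← hyn]
  have := card_le_card hsub
  rwa [card_image_of_injective _ hvinj, card_range] at this

/-! ### The upper bound and the theorem -/

/-- The tight bound for finite families of boxes. -/
theorem PQOn.piercedBy_box {ι κ : Type} [DecidableEq κ] {a b : ι → κ → ℝ}
    (hab : ∀ i, a i ≤ b i) {D : Finset κ} {e p q : ℕ} (hD : D.card = e + 1) {A : Finset ι}
    (hA : PQOn (fun i => partialBox D (a i) (b i)) A p q) (hp : 2 ≤ p)
    (hpq : 100 * Real.logb 2 p ^ e < q) :
    PiercedBy (fun i => partialBox D (a i) (b i)) A (p - q + 1) := by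
  classical
  set F := fun i => partialBox D (a i) (b i) with hFdef
  have hF : ∀ i, (F i).Nonempty := partialBox_nonempty hab
  have hH : HellyTwo F := hellyTwo_partialBox hab D
  have hle := hA.le
  have hlog : ∀ {n : ℕ}, 2 ^ n ≤ p → (n : ℝ) ≤ Real.logb 2 p := by
    intro n hn
    rw [Real.le_logb_iff_rpow_le (by norm_num) (by positivity), Real.rpow_natCast]
    exact_mod_cast hn
  have hpow : ∀ {n : ℕ}, 2 ^ n ≤ p → 100 * n ^ e < q := by
    intro n hn
    have h1 : (n : ℝ) ^ e ≤ Real.logb 2 p ^ e := by gcongr; exact hlog hn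
    have : (100 * n ^ e : ℝ) < q := by linarith
    exact_mod_cast this
  have hq100 : 100 < q := by simpa using hpow (n := 1) hp
  have hq4 : 100 * 4 ^ e < q := hpow (n := 4) (by lia)
  have h4 : 0 < 4 ^ e := by positivity
  obtain ⟨S, hS⟩ := exists_isMaxMatching F A
  obtain ⟨hSp, hA1⟩ := hA.sdiff (by lia) hS.1 hS.2.1
  have hle1 := hA1.le
  rcases lt_or_ge (p - S.card) (3 * q) with hr | hr
  · obtain ⟨T, hT⟩ := exists_isMaxMatching F (A \ S)
    rcases le_or_gt T.card 1 with hT1 | hT1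
    · exact (hS.piercedBy_of_clique hF hH (hT.2.2.mono hT1)).mono (by lia)
    obtain ⟨hTp, hA2⟩ := hA1.sdiff (by lia) hT.1 hT.2.1
    have hle2 := hA2.le
    -- Here `8 = 2 ^ 3`, and `boxBound_succ_le` at `k = 3` gives `2 ^ 4 * 4 ^ e`. The margin `q >
    -- 100 * 4 ^ e` covers four times this.
    have hG : ∀ B, MatchingLE F B 8 → PiercedBy F B (16 * 4 ^ e) := by
      intro B hB
      refine (piercedBy_partialBox hab D 3 B hB).mono ?_
      rw [hD]
      exact (boxBound_succ_le e 3).trans (Nat.sub_le _ _)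
    exact (hS.piercedBy_add hF hT
      (hA2.piercedBy_of_large hF hH (by lia) hG _ _ _ (by lia))).mono (by lia)
  · obtain ⟨B, s, w, hB, -, hs, h1, h2⟩ := hA.exists_layers hF ((q - 2) / 2) p q A S
      (by lia) hS
    -- From `2 * s ≤ p + |S|`, the cost `s + n` falls short of `p` by at least `(p - |S|) / 2 - n`.
    -- This is at least `(p - |S|) / 3 ≥ q`.
    have hsw : ∀ n, PiercedBy F B n → 6 * n ≤ p - S.card → PiercedBy F A (p - q + 1) :=
      fun n hn h => (hs n hn).mono (by lia)
    rcases Nat.eq_zero_or_pos w with rfl | hw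
    · exact hsw 0 (piercedBy_of_matchingLE_zero hB) (by lia)
    -- The factor 25/24 absorbs the loss in rounding `q` down to `2 * ((q - 2) / 2) ≥ q - 3`, as `q
    -- > 100`.
    have hqw : 24 * (q * w) ≤ 25 * (p - S.card) := by
      have h3 : 24 * q ≤ 25 * (2 * ((q - 2) / 2)) := by lia
      have h4 := Nat.mul_le_mul_right w h3
      have h5 : 2 * ((q - 2) / 2) * w ≤ p - S.card := by lia
      calc 24 * (q * w) = 24 * q * w := by ring
        _ ≤ 25 * (2 * ((q - 2) / 2)) * w := h4
        _ = 25 * (2 * ((q - 2) / 2) * w) := by ring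
        _ ≤ _ := by gcongr
    set k := Nat.clog 2 w with hk
    have hwk : w ≤ 2 ^ k := Nat.le_pow_clog (by norm_num) w
    have hkw : 2 ^ k ≤ 2 * w := by
      rcases Nat.eq_zero_or_pos k with h0 | h0
      · rw [h0]
        lia
      · have := Nat.pow_pred_clog_lt_self (b := 2) (by norm_num) (x := w) (by
          by_contra! hw1
          have : k = 0 := Nat.clog_of_right_le_one hw1 2
          lia)
        obtain ⟨l, hl⟩ := Nat.exists_eq_succ_of_ne_zero h0.ne'
        rw [← hk, hl, Nat.pred_succ] at this
        rw [hl, pow_succ]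
        lia
    -- This makes `k + 1 ≤ log₂ p`, so the hypothesis on `q` dominates the factor `(k + 1) ^ e` in
    -- the bound for boxes.
    have hkp : 2 ^ (k + 1) ≤ p := by
      have : 100 * w ≤ q * w := by gcongr
      rw [pow_succ]
      lia
    have hkq := hpow hkp
    refine hsw _ (piercedBy_partialBox hab D k B (hB.mono hwk)) ?_
    have h6 : boxBound D.card k ≤ 4 * w * (k + 1) ^ e := by
      rw [hD]
      refine (boxBound_succ_le e k).trans ((Nat.sub_le _ _).trans ?_)
      gcongr
      rw [pow_succ]
      lia
    have h7 : 4 * w * (100 * (k + 1) ^ e) ≤ 4 * w * q := by gcongr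
    have h8 : 4 * w * (100 * (k + 1) ^ e) = 100 * (4 * w * (k + 1) ^ e) := by ring
    have h9 : 4 * w * q = 4 * (q * w) := by ring
    lia

theorem mainTheorem3 :
    ∃ c : ℝ, 0 < c ∧ ∀ d p q : ℕ, 1 ≤ d → 2 ≤ q → q ≤ p →
      c * (Real.logb 2 (p : ℝ)) ^ (d - 1) < (q : ℝ) →
      IsHDNumber (axisParallelBoxes d) p q (p - q + 1) := by
  refine ⟨100, by norm_num, fun d p q hd hq hqp hpq => ⟨fun ι F hF hPQ => ?_,
    fun t ht => le_of_forall_canBePierced hd (by lia) hqp ht⟩⟩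
  choose a b hab hFab using hF
  have hbox : F = fun i => partialBox univ (a i) (b i) := by
    funext i
    rw [hFab i]
    ext x
    simp [partialBox, Pi.le_def, forall_and]
  refine canBePierced_of_forall_piercedBy (fun i => hFab i ▸ isCompact_Icc) fun A => ?_
  obtain ⟨B, hAB, hB⟩ := hPQ.exists_pqOn A
  rw [hbox] at hB ⊢
  exact (hB.piercedBy_box hab (e := d - 1) (by simp; lia) (by lia) hpq).subset hAB
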